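/- Let $\mathcal{P}_2(\mathbb{R})$ be the set of Borel probability measures on $\mathbb{R}$ with finite second moment, with the 2-Wasserstein distance $\mathrm{W}_2(\mu,\nu)=\big(\inf_{\gamma}\int |x-y|^2\,\mathrm{d}\gamma(x,y)\big)^{1/2}$, the infimum being over all couplings $\gamma$ of $\mu$ and $\nu$. A (constant-speed) geodesic between $\mu_0$ and $\mu_1$ is a curve $(\mu_t)_{t\in[0,1]}$ in $\mathcal{P}_2(\mathbb{R})$ from $\mu_0$ to $\mu_1$ such that $\mathrm{W}_2(\mu_t,\mu_s)=|t-s|\,\mathrm{W}_2(\mu_0,\mu_1)$ for all $s,t\in[0,1]$. It is called a ray if it can be extended to a curve $(\mu_t)_{t\ge 0}$ in $\mathcal{P}_2(\mathbb{R})$ for which this identity holds for all $s,t\ge 0$. Let $\mu_0=\mathcal{N}(m_0,\sigma_0^2)$ and $\mu_1=\mathcal{N}(m_1,\sigma_1^2)$ with $m_0,m_1\in\mathbb{R}$ and $\sigma_0,\sigma_1\ge 0$ (where $\mathcal{N}(m,0)=\delta_m$). Then there is exactly one geodesic between $\mu_0$ and $\mu_1$, and it is a ray if and only if $\sigma_1\ge\sigma_0$.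 -/

import Mathlib

open MeasureTheory ProbabilityTheory
open scoped NNReal ENNReal

noncomputable section

/-- The space `𝒫₂(ℝ)` of Borel probability measures on `ℝ` with finite second moment. -/
abbrev P2 : Type :=
  {μ : Measure ℝ // IsProbabilityMeasure μ ∧ Integrable (fun x : ℝ => x ^ 2) μ}

/-- The set `Π(μ, ν)` of couplings of `μ` and `ν`. -/
def couplings (μ ν : Measure ℝ) : Set (Measure (ℝ × ℝ)) :=
  {γ | IsProbabilityMeasure γ ∧ γ.map Prod.fst = μ ∧ γ.map Prod.snd = ν}

/-- The optimal transport cost `inf_{γ ∈ Π(μ, ν)} ∫ |x - y|² dγ(x, y)`, in `[0, ∞]`. -/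
def transportCost (μ ν : Measure ℝ) : ℝ≥0∞ :=
  ⨅ γ ∈ couplings μ ν, ∫⁻ p : ℝ × ℝ, ‖p.1 - p.2‖ₑ ^ 2 ∂γ

/-- The 2-Wasserstein distance on `𝒫₂(ℝ)`. The cost is finite there, so that `toReal` loses
nothing. -/
def W2 (μ ν : P2) : ℝ :=
  √(transportCost μ.1 ν.1).toReal

/-- `c : [0, 1] → 𝒫₂(ℝ)` is a constant-speed geodesic from `μ` to `ν`. -/
structure IsGeodesicBetween (μ ν : P2) (c : unitInterval → P2) : Prop where
  source : c 0 = μ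
  target : c 1 = ν
  dist_eq : ∀ s t : unitInterval, W2 (c t) (c s) = |(t : ℝ) - (s : ℝ)| * W2 μ ν

/-- `r : ℝ₊ → 𝒫₂(ℝ)` is a geodesic ray. -/
def IsGeodesicRay (r : ℝ≥0 → P2) : Prop :=
  ∀ s t : ℝ≥0, W2 (r t) (r s) = |(t : ℝ) - (s : ℝ)| * W2 (r 0) (r 1)

/-- The curve `c`, defined on `[0, 1]`, is a ray: it can be extended to a geodesic ray
defined on `ℝ₊`. -/
def IsRay (c : unitInterval → P2) : Prop :=
  ∃ r : ℝ≥0 → P2, IsGeodesicRay r ∧ ∀ t : unitInterval, r (unitInterval.toNNReal t) = c t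

/-- The Gaussian `𝒩(m, σ²)` as an element of `𝒫₂(ℝ)`; it is the Dirac mass at `m` if `σ = 0`. -/
def gaussianP2 (m : ℝ) (σ : ℝ≥0) : P2 :=
  ⟨gaussianReal m (σ ^ 2), inferInstance, (memLp_id_gaussianReal 2).integrable_sq⟩

end

/-! Let G be standard normal. As 𝒩(m, σ²) is the law of m + σG, each of its couplings with ν comes
from a coupling of G with some Y ~ ν. Expanding the square gives W₂² = (m - a)² + σ² + s² - 2σk,
where a and s are the mean and standard deviation of ν and k = sup 𝔼[GY] (`P2.W2_gaussian_sq`). The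
number k depends on ν alone, 0 ≤ k ≤ s, and k = s only if ν is Gaussian.

Gaussians thus form the Euclidean half-plane of points (m, σ), σ ≥ 0, and segments in it are
geodesics. They are unique even among non-Gaussian curves: a weighted sum of the two endpoint
identities is a sum of nonnegative terms that vanish only at the interpolated Gaussian
(`eq_gaussianInterp`). If σ₀ ≤ σ₁, the half-line stays in the half-plane. If σ₁ < σ₀, the endpoint
identities at a late time contradict k ≥ 0 (`IsGeodesicRay.le_of_gaussian`). -/

/-! ### Couplings with a Gaussian marginal -/

/-- The product measure is a coupling. -/
lemma prod_mem_couplings (μ ν : Measure ℝ) [IsProbabilityMeasure μ] [IsProbabilityMeasure ν] :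
    μ.prod ν ∈ couplings μ ν :=
  ⟨inferInstance, by simp [Measure.map_fst_prod], by simp [Measure.map_snd_prod]⟩

/-- Pushing the first marginal of a coupling forward. -/
lemma map_fst_mem_couplings {μ μ' ν : Measure ℝ} {f : ℝ → ℝ} (hf : Measurable f)
    (hμ : μ.map f = μ') {γ : Measure (ℝ × ℝ)} (hγ : γ ∈ couplings μ ν) :
    γ.map (fun p => (f p.1, p.2)) ∈ couplings μ' ν := by
  obtain ⟨hp, h1, h2⟩ := hγ
  have hm : Measurable (fun p : ℝ × ℝ => (f p.1, p.2)) := by fun_prop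
  refine ⟨Measure.isProbabilityMeasure_map hm.aemeasurable, ?_, ?_⟩
  · rw [Measure.map_map measurable_fst hm, ← hμ, ← h1, Measure.map_map hf measurable_fst]
    rfl
  · rw [Measure.map_map measurable_snd hm, ← h2]
    rfl

/-- An affine image of the standard Gaussian. -/
lemma gaussianReal_map_affine (m : ℝ) (σ : ℝ≥0) :
    (gaussianReal 0 1).map (fun x => m + σ * x) = gaussianReal m (σ ^ 2) := by
  have : (fun x : ℝ => m + σ * x) = (fun x => m + x) ∘ (fun x => (σ : ℝ) * x) := rfl
  rw [this, ← Measure.map_map (by fun_prop) (by fun_prop), gaussianReal_map_const_mul,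
    gaussianReal_map_const_add]
  congr 1
  · simp
  · ext; simp

/-- Each coupling of a Gaussian with `ν` comes from a coupling of the standard Gaussian
with `ν`. -/
lemma exists_standard_coupling {m : ℝ} {σ : ℝ≥0} {ν : Measure ℝ} [IsProbabilityMeasure ν]
    {γ : Measure (ℝ × ℝ)} (hγ : γ ∈ couplings (gaussianReal m (σ ^ 2)) ν) :
    ∃ γ' ∈ couplings (gaussianReal 0 1) ν, γ = γ'.map (fun p => (m + σ * p.1, p.2)) := by
  rcases eq_or_ne σ 0 with rfl | hσ
  · refine ⟨_, prod_mem_couplings _ ν, ?_⟩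
    obtain ⟨-, h1, h2⟩ := hγ
    have hae : ∀ᵐ p ∂γ, p = (m, p.2) := by
      have h : ∀ᵐ x ∂(γ.map Prod.fst), x = m := by
        rw [h1]
        simp [gaussianReal_zero_var, ae_dirac_eq]
      filter_upwards [ae_of_ae_map measurable_fst.aemeasurable h] with p hp
      exact Prod.ext hp rfl
    -- Overwriting the first coordinate by m leaves only the second marginal, so when σ = 0 the
    -- product coupling serves as a lift.
    have key : ∀ η : Measure (ℝ × ℝ), η.map (fun p => (m, p.2)) =
        (η.map Prod.snd).map (fun y => (m, y)) := fun η => by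
      rw [Measure.map_map (by fun_prop) (by fun_prop)]
      rfl
    calc γ = γ.map id := Measure.map_id.symm
      _ = γ.map (fun p => (m, p.2)) := Measure.map_congr hae
      _ = _ := by
        rw [key, h2, ← (prod_mem_couplings (gaussianReal 0 1) ν).2.2, ← key]
        simp
  · have hσ' : (σ : ℝ) ≠ 0 := by exact_mod_cast hσ
    refine ⟨_, map_fst_mem_couplings (f := fun x => (x - m) / σ) (by fun_prop) ?_ hγ, ?_⟩
    · rw [← gaussianReal_map_affine, Measure.map_map (by fun_prop) (by fun_prop)]
      have : (fun x : ℝ => (x - m) / σ) ∘ (fun x => m + σ * x) = id := by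
        ext x
        simp [hσ']
      rw [this, Measure.map_id]
    · rw [Measure.map_map (by fun_prop) (by fun_prop)]
      have : (fun p : ℝ × ℝ => (m + σ * p.1, p.2)) ∘ (fun p => ((p.1 - m) / σ, p.2)) = id := by
        ext p
        · simp only [Function.comp_apply, id_eq]
          field_simp
          ring
        · simp
      rw [this, Measure.map_id]

lemma memLp_two_of_map_fst {μ ν : Measure ℝ} {γ : Measure (ℝ × ℝ)} (hγ : γ ∈ couplings μ ν)
    (h : MemLp id 2 μ) : MemLp (fun p : ℝ × ℝ => p.1) 2 γ := by
  rw [← hγ.2.1] at h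
  exact h.comp_of_map (by fun_prop)

lemma memLp_two_of_map_snd {μ ν : Measure ℝ} {γ : Measure (ℝ × ℝ)} (hγ : γ ∈ couplings μ ν)
    (h : MemLp id 2 ν) : MemLp (fun p : ℝ × ℝ => p.2) 2 γ := by
  rw [← hγ.2.2] at h
  exact h.comp_of_map (by fun_prop)

lemma integral_fst_of_coupling {μ ν : Measure ℝ} {γ : Measure (ℝ × ℝ)} (hγ : γ ∈ couplings μ ν)
    {f : ℝ → ℝ} (hf : Measurable f) : ∫ p, f p.1 ∂γ = ∫ x, f x ∂μ := by
  rw [← hγ.2.1, integral_map measurable_fst.aemeasurable hf.aestronglyMeasurable]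

lemma integral_snd_of_coupling {μ ν : Measure ℝ} {γ : Measure (ℝ × ℝ)} (hγ : γ ∈ couplings μ ν)
    {f : ℝ → ℝ} (hf : Measurable f) : ∫ p, f p.2 ∂γ = ∫ x, f x ∂ν := by
  rw [← hγ.2.2, integral_map measurable_snd.aemeasurable hf.aestronglyMeasurable]

/-! ### Maximal correlation and the distance to a Gaussian -/

namespace P2

lemma isProbabilityMeasure (ν : P2) : IsProbabilityMeasure ν.1 := ν.2.1

lemma memLp (ν : P2) : MemLp id 2 ν.1 :=
  (memLp_two_iff_integrable_sq (by fun_prop)).2 ν.2.2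

/-- The mean of a measure in `𝒫₂(ℝ)`. -/
noncomputable def mean (ν : P2) : ℝ := ∫ x, x ∂ν.1

/-- The standard deviation of a measure in `𝒫₂(ℝ)`. -/
noncomputable def stdDev (ν : P2) : ℝ := √(variance id ν.1)

lemma stdDev_nonneg (ν : P2) : 0 ≤ ν.stdDev := Real.sqrt_nonneg _

lemma integral_sq (ν : P2) : ∫ x, x ^ 2 ∂ν.1 = ν.stdDev ^ 2 + ν.mean ^ 2 := by
  have := ν.isProbabilityMeasure
  rw [stdDev, Real.sq_sqrt (variance_nonneg _ _), variance_eq_sub ν.memLp]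
  simp [mean]

/-- The correlations of the standard Gaussian with `ν` realised by couplings. -/
def correlations (ν : P2) : Set ℝ :=
  (fun γ : Measure (ℝ × ℝ) => ∫ p, p.1 * p.2 ∂γ) '' couplings (gaussianReal 0 1) ν.1

/-- The maximal correlation of the standard Gaussian with `ν`. -/
noncomputable def maxCorr (ν : P2) : ℝ := sSup ν.correlations

/-- Only the cross term depends on the coupling. Here σ is any real number, so that a correlation of
unknown sign may be substituted for it. -/
lemma integral_cost (ν : P2) {γ : Measure (ℝ × ℝ)} (hγ : γ ∈ couplings (gaussianReal 0 1) ν.1)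
    (m σ : ℝ) :
    Integrable (fun p : ℝ × ℝ => (m + σ * p.1 - p.2) ^ 2) γ ∧
      ∫ p, (m + σ * p.1 - p.2) ^ 2 ∂γ =
        (m - ν.mean) ^ 2 + σ ^ 2 + ν.stdDev ^ 2 - 2 * σ * ∫ p, p.1 * p.2 ∂γ := by
  have := hγ.1
  have h1 := memLp_two_of_map_fst hγ (memLp_id_gaussianReal 2)
  have h2 := memLp_two_of_map_snd hγ ν.memLp
  have i1 := h1.integrable one_le_two
  have i2 := h2.integrable one_le_two
  have i11 := h1.integrable_sq
  have i22 := h2.integrable_sq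
  have i12 : Integrable (fun p : ℝ × ℝ => p.1 * p.2) γ := h1.integrable_mul h2
  have e1 : ∫ p, p.1 ∂γ = 0 := by
    rw [integral_fst_of_coupling hγ (f := fun x => x) (by fun_prop)]
    simp
  have e2 : ∫ p, p.2 ∂γ = ν.mean :=
    integral_snd_of_coupling hγ (f := fun x => x) (by fun_prop)
  have e11 : ∫ p, p.1 ^ 2 ∂γ = 1 := by
    rw [integral_fst_of_coupling hγ (f := fun x => x ^ 2) (by fun_prop)]
    have := variance_eq_sub (memLp_id_gaussianReal (μ := 0) (v := 1) 2)
    simpa using this.symm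
  have e22 : ∫ p, p.2 ^ 2 ∂γ = ν.stdDev ^ 2 + ν.mean ^ 2 := by
    rw [integral_snd_of_coupling hγ (f := fun x => x ^ 2) (by fun_prop), integral_sq]
  have hexp : (fun p : ℝ × ℝ => (m + σ * p.1 - p.2) ^ 2) = fun p =>
      m ^ 2 + σ ^ 2 * p.1 ^ 2 + p.2 ^ 2 + 2 * m * σ * p.1 - 2 * m * p.2
        - 2 * σ * (p.1 * p.2) := by
    ext p
    ring
  have j0 : Integrable (fun _ : ℝ × ℝ => m ^ 2) γ := integrable_const _
  have j1 := j0.add (i11.const_mul (σ ^ 2))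
  have j2 := j1.add i22
  have j3 := j2.add (i1.const_mul (2 * m * σ))
  have j4 := j3.sub (i2.const_mul (2 * m))
  have j5 := j4.sub (i12.const_mul (2 * σ))
  rw [hexp]
  refine ⟨j5, ?_⟩
  have k5 := integral_sub j4 (i12.const_mul (2 * σ))
  have k4 := integral_sub j3 (i2.const_mul (2 * m))
  have k3 := integral_add j2 (i1.const_mul (2 * m * σ))
  have k2 := integral_add j1 i22
  have k1 := integral_add j0 (i11.const_mul (σ ^ 2))
  simp only [Pi.add_apply, Pi.sub_apply, integral_const_mul, integral_const, e1, e2, e11, e22]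
    at k1 k2 k3 k4 k5
  rw [k5, k4, k3, k2, k1]
  simp
  ring

lemma lintegral_cost (ν : P2) {γ : Measure (ℝ × ℝ)} (hγ : γ ∈ couplings (gaussianReal 0 1) ν.1)
    (m σ : ℝ) :
    ∫⁻ p : ℝ × ℝ, ‖p.1 - p.2‖ₑ ^ 2 ∂(γ.map (fun p => (m + σ * p.1, p.2))) =
      ENNReal.ofReal ((m - ν.mean) ^ 2 + σ ^ 2 + ν.stdDev ^ 2 - 2 * σ * ∫ p, p.1 * p.2 ∂γ) := by
  rw [lintegral_map (by fun_prop) (by fun_prop), ← (ν.integral_cost hγ m σ).2,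
    ofReal_integral_eq_lintegral_ofReal (ν.integral_cost hγ m σ).1
      (Filter.Eventually.of_forall fun p => sq_nonneg _)]
  refine lintegral_congr fun p => ?_
  rw [← sq_abs, ENNReal.ofReal_pow (abs_nonneg _), Real.enorm_eq_ofReal_abs]

lemma correlation_le_stdDev (ν : P2) {k : ℝ} (hk : k ∈ ν.correlations) : k ≤ ν.stdDev := by
  obtain ⟨γ, hγ, rfl⟩ := hk
  set k := ∫ p, p.1 * p.2 ∂γ
  -- The residual of the linear regression of Y on G has second moment s² - k².
  have h : 0 ≤ ∫ p, (ν.mean + k * p.1 - p.2) ^ 2 ∂γ := integral_nonneg fun p => sq_nonneg _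
  rw [(ν.integral_cost hγ ν.mean k).2] at h
  exact le_of_abs_le (abs_le_of_sq_le_sq (by simp only [sub_self] at h; linarith) ν.stdDev_nonneg)

lemma bddAbove_correlations (ν : P2) : BddAbove ν.correlations :=
  ⟨_, fun _ hk => ν.correlation_le_stdDev hk⟩

lemma zero_mem_correlations (ν : P2) : 0 ∈ ν.correlations := by
  have := ν.isProbabilityMeasure
  refine ⟨_, prod_mem_couplings _ _, ?_⟩
  simp [integral_prod_mul (fun x : ℝ => x) (fun x : ℝ => x)]

lemma maxCorr_nonneg (ν : P2) : 0 ≤ ν.maxCorr :=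
  le_csSup ν.bddAbove_correlations ν.zero_mem_correlations

lemma maxCorr_le_stdDev (ν : P2) : ν.maxCorr ≤ ν.stdDev :=
  csSup_le ⟨_, ν.zero_mem_correlations⟩ fun _ hk => ν.correlation_le_stdDev hk

/-- Since k ≤ s, the expression is at least (m - a)² + (σ - s)². -/
lemma gaussian_cost_nonneg (ν : P2) (m : ℝ) (σ : ℝ≥0) :
    0 ≤ (m - ν.mean) ^ 2 + σ ^ 2 + ν.stdDev ^ 2 - 2 * σ * ν.maxCorr := by
  have := mul_le_mul_of_nonneg_left ν.maxCorr_le_stdDev σ.coe_nonneg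
  nlinarith [sq_nonneg (m - ν.mean), sq_nonneg ((σ : ℝ) - ν.stdDev)]

lemma transportCost_gaussian (ν : P2) (m : ℝ) (σ : ℝ≥0) :
    transportCost (gaussianP2 m σ).1 ν.1 =
      ENNReal.ofReal ((m - ν.mean) ^ 2 + σ ^ 2 + ν.stdDev ^ 2 - 2 * σ * ν.maxCorr) := by
  have := ν.isProbabilityMeasure
  have hle : ∀ k ∈ ν.correlations, transportCost (gaussianP2 m σ).1 ν.1 ≤
      ENNReal.ofReal ((m - ν.mean) ^ 2 + σ ^ 2 + ν.stdDev ^ 2 - 2 * σ * k) := by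
    rintro k ⟨γ, hγ, rfl⟩
    simp only
    rw [← ν.lintegral_cost hγ]
    exact iInf₂_le _ (map_fst_mem_couplings (by fun_prop) (gaussianReal_map_affine m σ) hγ)
  apply le_antisymm
  · have hcont : Continuous fun k : ℝ =>
        ENNReal.ofReal ((m - ν.mean) ^ 2 + σ ^ 2 + ν.stdDev ^ 2 - 2 * σ * k) :=
      ENNReal.continuous_ofReal.comp (by fun_prop)
    have hcl : IsClosed {k : ℝ | transportCost (gaussianP2 m σ).1 ν.1 ≤
        ENNReal.ofReal ((m - ν.mean) ^ 2 + σ ^ 2 + ν.stdDev ^ 2 - 2 * σ * k)} :=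
      isClosed_le continuous_const hcont
    exact hcl.closure_subset_iff.2 hle
      (csSup_mem_closure ⟨_, ν.zero_mem_correlations⟩ ν.bddAbove_correlations)
  · refine le_iInf₂ fun γ hγ => ?_
    obtain ⟨γ', hγ', rfl⟩ := exists_standard_coupling hγ
    rw [ν.lintegral_cost hγ']
    have := mul_le_mul_of_nonneg_left
      (le_csSup ν.bddAbove_correlations (Set.mem_image_of_mem _ hγ')) σ.coe_nonneg
    exact ENNReal.ofReal_le_ofReal (by rw [maxCorr]; linarith)

/-- The Wasserstein distance of a Gaussian to an arbitrary measure. -/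
lemma W2_gaussian_sq (ν : P2) (m : ℝ) (σ : ℝ≥0) :
    W2 (gaussianP2 m σ) ν ^ 2 =
      (m - ν.mean) ^ 2 + σ ^ 2 + ν.stdDev ^ 2 - 2 * σ * ν.maxCorr := by
  rw [W2, Real.sq_sqrt ENNReal.toReal_nonneg, transportCost_gaussian,
    ENNReal.toReal_ofReal (ν.gaussian_cost_nonneg m σ)]

@[simp] lemma mean_gaussianP2 (m : ℝ) (σ : ℝ≥0) : (gaussianP2 m σ).mean = m := by
  simp [mean, gaussianP2]

@[simp] lemma stdDev_gaussianP2 (m : ℝ) (σ : ℝ≥0) : (gaussianP2 m σ).stdDev = σ := by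
  simp [stdDev, gaussianP2]

-- The coupling (G, m + σG) attains the upper bound s = σ.
@[simp] lemma maxCorr_gaussianP2 (m : ℝ) (σ : ℝ≥0) : (gaussianP2 m σ).maxCorr = σ := by
  refine le_antisymm ((maxCorr_le_stdDev _).trans_eq (stdDev_gaussianP2 m σ))
    (le_csSup (bddAbove_correlations _)
      ⟨(gaussianReal 0 1).map (fun x => (x, m + σ * x)), ⟨?_, ?_, ?_⟩, ?_⟩)
  · exact Measure.isProbabilityMeasure_map (by fun_prop)
  · rw [Measure.map_map (by fun_prop) (by fun_prop)]
    exact Measure.map_id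
  · rw [Measure.map_map (by fun_prop) (by fun_prop)]
    exact gaussianReal_map_affine m σ
  · have h := memLp_id_gaussianReal (μ := 0) (v := 1) 2
    have e : ∫ x : ℝ, x ^ 2 ∂(gaussianReal 0 1) = 1 := by
      have := variance_eq_sub h
      simpa using this.symm
    have i1 : Integrable (fun x : ℝ => m * x) (gaussianReal 0 1) :=
      (h.integrable one_le_two).const_mul m
    have i2 : Integrable (fun x : ℝ => (σ : ℝ) * x ^ 2) (gaussianReal 0 1) :=
      h.integrable_sq.const_mul _
    simp only
    rw [integral_map (by fun_prop) (by fun_prop)]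
    have hexp : (fun x : ℝ => x * (m + σ * x)) = fun x => m * x + σ * x ^ 2 := by
      ext x
      ring
    simp only [hexp]
    rw [integral_add i1 i2, integral_const_mul, integral_const_mul, e]
    simp

end P2

lemma W2_gaussian_gaussian (m m' : ℝ) (σ σ' : ℝ≥0) :
    W2 (gaussianP2 m σ) (gaussianP2 m' σ') = √((m - m') ^ 2 + ((σ : ℝ) - σ') ^ 2) := by
  rw [← Real.sqrt_sq (show 0 ≤ W2 (gaussianP2 m σ) (gaussianP2 m' σ') from Real.sqrt_nonneg _),
    P2.W2_gaussian_sq]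
  simp only [P2.mean_gaussianP2, P2.stdDev_gaussianP2, P2.maxCorr_gaussianP2]
  congr 1
  ring

/-! ### Separation of measures by the transport cost -/

/-- The characteristic functions of the marginals of a coupling differ by at most `L²` cost. -/
lemma norm_charFun_sub_le {μ ν : Measure ℝ} {γ : Measure (ℝ × ℝ)} (hγ : γ ∈ couplings μ ν)
    (t : ℝ) :
    ‖charFun μ t - charFun ν t‖ₑ ^ 2 ≤ ‖t‖ₑ ^ 2 * ∫⁻ p : ℝ × ℝ, ‖p.1 - p.2‖ₑ ^ 2 ∂γ := by
  obtain ⟨hp, h1, h2⟩ := hγ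
  have hi : ∀ f : ℝ × ℝ → ℝ, Measurable f →
      Integrable (fun p => Complex.exp (t * f p * Complex.I)) γ := fun f hf =>
    Integrable.of_bound (by fun_prop) 1 (Filter.Eventually.of_forall fun p => by
      rw [← Complex.ofReal_mul, Complex.norm_exp_ofReal_mul_I])
  have hsub : charFun μ t - charFun ν t =
      ∫ p, (Complex.exp (t * p.1 * Complex.I) - Complex.exp (t * p.2 * Complex.I)) ∂γ := by
    rw [charFun_apply_real, charFun_apply_real, ← h1, ← h2, integral_map (by fun_prop)
      (by fun_prop), integral_map (by fun_prop) (by fun_prop),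
      integral_sub (hi _ measurable_fst) (hi _ measurable_snd)]
  have hpt : ∀ p : ℝ × ℝ, ‖Complex.exp (t * p.1 * Complex.I) -
      Complex.exp (t * p.2 * Complex.I)‖ₑ ≤ ‖t‖ₑ * ‖p.1 - p.2‖ₑ := fun p => by
    have : Complex.exp (t * p.1 * Complex.I) - Complex.exp (t * p.2 * Complex.I) =
        Complex.exp ((t * p.2 : ℝ) * Complex.I) *
          (Complex.exp (Complex.I * (t * (p.1 - p.2) : ℝ)) - 1) := by
      rw [mul_sub, ← Complex.exp_add]
      push_cast
      ring_nf
    rw [this, enorm_mul, ← enorm_mul t, ← ofReal_norm (Complex.exp ((t * p.2 : ℝ) * _)),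
      Complex.norm_exp_ofReal_mul_I, ENNReal.ofReal_one, one_mul]
    exact Real.enorm_exp_I_mul_ofReal_sub_one_le
  -- Cauchy–Schwarz against the constant 1, with γ of mass one.
  have hcs : (∫⁻ p : ℝ × ℝ, ‖p.1 - p.2‖ₑ ∂γ) ^ 2 ≤ ∫⁻ p : ℝ × ℝ, ‖p.1 - p.2‖ₑ ^ 2 ∂γ := by
    have h := ENNReal.lintegral_mul_le_Lp_mul_Lq γ Real.HolderConjugate.two_two
      (f := fun p : ℝ × ℝ => ‖p.1 - p.2‖ₑ) (g := fun _ => 1) (by fun_prop) (by fun_prop)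
    simp only [Pi.mul_apply, mul_one, ENNReal.one_rpow, lintegral_const, measure_univ] at h
    calc _ ≤ ((∫⁻ p : ℝ × ℝ, ‖p.1 - p.2‖ₑ ^ (2 : ℝ) ∂γ) ^ (1 / (2 : ℝ))) ^ 2 := by gcongr
      _ = _ := by
        rw [← ENNReal.rpow_natCast, ← ENNReal.rpow_mul]
        norm_num
  calc ‖charFun μ t - charFun ν t‖ₑ ^ 2
      ≤ (∫⁻ p : ℝ × ℝ, ‖t‖ₑ * ‖p.1 - p.2‖ₑ ∂γ) ^ 2 := by
        rw [hsub]
        gcongr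
        exact (enorm_integral_le_lintegral_enorm _).trans (lintegral_mono hpt)
    _ = ‖t‖ₑ ^ 2 * (∫⁻ p : ℝ × ℝ, ‖p.1 - p.2‖ₑ ∂γ) ^ 2 := by
        rw [lintegral_const_mul _ (by fun_prop), mul_pow]
    _ ≤ _ := by gcongr

/-- Measures in `𝒫₂(ℝ)` at distance zero agree. -/
lemma eq_of_transportCost_eq_zero {μ ν : P2} (h : transportCost μ.1 ν.1 = 0) : μ = ν := by
  have := μ.isProbabilityMeasure
  have := ν.isProbabilityMeasure
  refine Subtype.ext (Measure.ext_of_charFun (funext fun t => ?_))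
  rcases eq_or_ne t 0 with rfl | ht
  · simp
  have hle : ‖charFun μ.1 t - charFun ν.1 t‖ₑ ^ 2 ≤ ‖t‖ₑ ^ 2 * transportCost μ.1 ν.1 := by
    rw [transportCost]
    have hne : ‖t‖ₑ ^ 2 ≠ 0 := by simpa using ht
    rw [ENNReal.mul_iInf_of_ne hne (by simp)]
    refine le_iInf fun γ => ?_
    rw [ENNReal.mul_iInf_of_ne hne (by simp)]
    exact le_iInf fun hγ => norm_charFun_sub_le hγ t
  rw [h, mul_zero] at hle
  simpa [sub_eq_zero] using hle

/-- A measure whose correlation with the standard Gaussian is maximal is Gaussian. -/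
lemma P2.eq_gaussianP2_of_maxCorr (ν : P2) {m : ℝ} {σ : ℝ≥0} (hm : ν.mean = m)
    (hs : ν.stdDev = σ) (hk : ν.maxCorr = σ) : ν = gaussianP2 m σ := by
  refine (eq_of_transportCost_eq_zero ?_).symm
  rw [P2.transportCost_gaussian, hm, hs, hk, ENNReal.ofReal_eq_zero]
  apply le_of_eq
  ring

/-! ### Gaussian segments and uniqueness of geodesics -/

/-- The point at parameter `t ≥ 0` of the affine curve of Gaussians through `𝒩(m₀, σ₀²)` and
`𝒩(m₁, σ₁²)`. -/
noncomputable def gaussianInterp (m₀ m₁ : ℝ) (σ₀ σ₁ : ℝ≥0) (t : ℝ) : P2 :=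
  gaussianP2 ((1 - t) * m₀ + t * m₁) (Real.toNNReal ((1 - t) * σ₀ + t * σ₁))

/-- The hypotheses ensure that `Real.toNNReal` does not truncate, so that (m, σ) moves along a
straight line. -/
lemma W2_gaussianInterp {m₀ m₁ : ℝ} {σ₀ σ₁ : ℝ≥0} {s t : ℝ}
    (hs : 0 ≤ (1 - s) * (σ₀ : ℝ) + s * σ₁) (ht : 0 ≤ (1 - t) * (σ₀ : ℝ) + t * σ₁) :
    W2 (gaussianInterp m₀ m₁ σ₀ σ₁ t) (gaussianInterp m₀ m₁ σ₀ σ₁ s) =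
      |t - s| * W2 (gaussianP2 m₀ σ₀) (gaussianP2 m₁ σ₁) := by
  rw [gaussianInterp, gaussianInterp, W2_gaussian_gaussian, W2_gaussian_gaussian,
    Real.coe_toNNReal _ hs, Real.coe_toNNReal _ ht, ← Real.sqrt_sq_eq_abs,
    ← Real.sqrt_mul (sq_nonneg _)]
  congr 1
  ring

lemma gaussianInterp_zero (m₀ m₁ : ℝ) (σ₀ σ₁ : ℝ≥0) :
    gaussianInterp m₀ m₁ σ₀ σ₁ 0 = gaussianP2 m₀ σ₀ := by
  simp [gaussianInterp]

lemma gaussianInterp_one (m₀ m₁ : ℝ) (σ₀ σ₁ : ℝ≥0) :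
    gaussianInterp m₀ m₁ σ₀ σ₁ 1 = gaussianP2 m₁ σ₁ := by
  simp [gaussianInterp]

lemma stdDev_interp_nonneg (σ₀ σ₁ : ℝ≥0) (t : unitInterval) :
    0 ≤ (1 - (t : ℝ)) * (σ₀ : ℝ) + t * σ₁ :=
  add_nonneg (mul_nonneg (sub_nonneg.2 t.2.2) σ₀.coe_nonneg) (mul_nonneg t.2.1 σ₁.coe_nonneg)

lemma isGeodesicBetween_gaussianInterp (m₀ m₁ : ℝ) (σ₀ σ₁ : ℝ≥0) :
    IsGeodesicBetween (gaussianP2 m₀ σ₀) (gaussianP2 m₁ σ₁)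
      (fun t => gaussianInterp m₀ m₁ σ₀ σ₁ t) where
  source := gaussianInterp_zero m₀ m₁ σ₀ σ₁
  target := gaussianInterp_one m₀ m₁ σ₀ σ₁
  dist_eq s t := W2_gaussianInterp (stdDev_interp_nonneg σ₀ σ₁ s) (stdDev_interp_nonneg σ₀ σ₁ t)

/-- A measure dividing the segment between two Gaussians in the ratio `t : 1 - t` is the
interpolated Gaussian. -/
lemma eq_gaussianInterp {m₀ m₁ : ℝ} {σ₀ σ₁ : ℝ≥0} {t : ℝ} (ht : t ∈ Set.Icc (0 : ℝ) 1) {ν : P2}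
    (h₀ : W2 (gaussianP2 m₀ σ₀) ν = t * W2 (gaussianP2 m₀ σ₀) (gaussianP2 m₁ σ₁))
    (h₁ : W2 (gaussianP2 m₁ σ₁) ν = (1 - t) * W2 (gaussianP2 m₀ σ₀) (gaussianP2 m₁ σ₁)) :
    ν = gaussianInterp m₀ m₁ σ₀ σ₁ t := by
  have hD := P2.W2_gaussian_sq (gaussianP2 m₁ σ₁) m₀ σ₀
  have e₀ := ν.W2_gaussian_sq m₀ σ₀
  have e₁ := ν.W2_gaussian_sq m₁ σ₁
  simp only [P2.mean_gaussianP2, P2.stdDev_gaussianP2, P2.maxCorr_gaussianP2] at hD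
  rw [h₀, mul_pow, hD] at e₀
  rw [h₁, mul_pow, hD] at e₁
  have hk := ν.maxCorr_le_stdDev
  have hk0 := ν.maxCorr_nonneg
  have hσ : 0 ≤ (1 - t) * (σ₀ : ℝ) + t * σ₁ := stdDev_interp_nonneg σ₀ σ₁ ⟨t, ht⟩
  set m := ν.mean
  set s := ν.stdDev
  set k := ν.maxCorr
  -- Weights 1 - t and t turn the squared distances t²D² and (1 - t)²D² into t(1 - t)D², which
  -- cancels the spread of the endpoints. All three remaining terms are nonnegative.
  have key : (m - ((1 - t) * m₀ + t * m₁)) ^ 2 + (s - ((1 - t) * σ₀ + t * σ₁)) ^ 2 +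
      2 * (((1 - t) * σ₀ + t * σ₁) * (s - k)) = 0 := by
    linear_combination (-(1 - t)) * e₀ - t * e₁
  have hsk : 0 ≤ ((1 - t) * σ₀ + t * σ₁) * (s - k) := mul_nonneg hσ (sub_nonneg.2 hk)
  have hm : m = (1 - t) * m₀ + t * m₁ := by
    have : (m - ((1 - t) * m₀ + t * m₁)) ^ 2 = 0 := by nlinarith
    exact sub_eq_zero.1 (pow_eq_zero_iff two_ne_zero |>.1 this)
  have hs : s = (1 - t) * σ₀ + t * σ₁ := by
    have : (s - ((1 - t) * σ₀ + t * σ₁)) ^ 2 = 0 := by nlinarith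
    exact sub_eq_zero.1 (pow_eq_zero_iff two_ne_zero |>.1 this)
  have hks : k = s := by
    rw [← hs] at hsk key
    -- If s = 0, then 0 ≤ k ≤ s still forces k = s.
    have : s * (s - k) = 0 := by nlinarith
    rcases mul_eq_zero.1 this with h | h <;> linarith
  exact ν.eq_gaussianP2_of_maxCorr hm (hs.trans (Real.coe_toNNReal _ hσ).symm)
    ((hks.trans hs).trans (Real.coe_toNNReal _ hσ).symm)

lemma IsGeodesicBetween.eq_gaussianInterp {m₀ m₁ : ℝ} {σ₀ σ₁ : ℝ≥0} {c : unitInterval → P2}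
    (hc : IsGeodesicBetween (gaussianP2 m₀ σ₀) (gaussianP2 m₁ σ₁) c) (t : unitInterval) :
    c t = gaussianInterp m₀ m₁ σ₀ σ₁ t := by
  refine _root_.eq_gaussianInterp t.2 ?_ ?_
  · have := hc.dist_eq t 0
    rwa [hc.source, Set.Icc.coe_zero, zero_sub, abs_neg, abs_of_nonneg t.2.1] at this
  · have := hc.dist_eq t 1
    rwa [hc.target, Set.Icc.coe_one, abs_of_nonneg (sub_nonneg.2 t.2.2)] at this

/-! ### Rays -/

/-- A geodesic starting with two Gaussians of decreasing variance cannot be continued forever. -/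
lemma IsGeodesicRay.le_of_gaussian {m₀ m₁ : ℝ} {σ₀ σ₁ : ℝ≥0} {r : ℝ≥0 → P2}
    (hr : IsGeodesicRay r) (h₀ : r 0 = gaussianP2 m₀ σ₀) (h₁ : r 1 = gaussianP2 m₁ σ₁) :
    σ₀ ≤ σ₁ := by
  by_contra! hlt
  have hlt' : (σ₁ : ℝ) < σ₀ := by exact_mod_cast hlt
  have hσ₁ : 0 ≤ (σ₁ : ℝ) := σ₁.coe_nonneg
  set D := W2 (gaussianP2 m₀ σ₀) (gaussianP2 m₁ σ₁) with hDdef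
  have hD : D ^ 2 = (m₀ - m₁) ^ 2 + ((σ₀ : ℝ) - σ₁) ^ 2 := by
    rw [hDdef, W2_gaussian_gaussian, Real.sq_sqrt (by positivity)]
  have hD0 : 0 ≤ D := Real.sqrt_nonneg _
  -- Strict because σ₀ ≠ σ₁; this makes the gap below positive.
  have haD : |m₀ - m₁| < D := abs_lt_of_sq_lt_sq (by nlinarith) hD0
  have hDpos : 0 < D := (abs_nonneg _).trans_lt haD
  set K := (m₀ - m₁) ^ 2 + (σ₀ : ℝ) ^ 2 - σ₁ ^ 2 with hK
  have hK0 : 0 ≤ K := by nlinarith [sq_nonneg (m₀ - m₁)]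
  have hgap : 0 < 2 * D * (D - |m₀ - m₁|) := mul_pos (by linarith) (by linarith)
  -- Chosen so that the final inequality D² + 2uD(D - |m₀ - m₁|) ≤ K collapses to D² ≤ 0.
  set u := K / (2 * D * (D - |m₀ - m₁|)) with hu
  have hu0 : 0 ≤ u := div_nonneg hK0 hgap.le
  have huK : u * (2 * D * (D - |m₀ - m₁|)) = K := div_mul_cancel₀ _ hgap.ne'
  set t : ℝ≥0 := 1 + u.toNNReal with ht
  have htr : (t : ℝ) = 1 + u := by simp [ht, hu0]
  have d₀ := hr t 0
  have d₁ := hr t 1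
  rw [h₀, h₁, ← hDdef, htr, NNReal.coe_zero, zero_sub, abs_neg,
    abs_of_nonneg (by linarith)] at d₀
  rw [h₀, h₁, ← hDdef, htr, NNReal.coe_one, sub_add_cancel_left, abs_neg,
    abs_of_nonneg hu0] at d₁
  have e₀ := (r t).W2_gaussian_sq m₀ σ₀
  have e₁ := (r t).W2_gaussian_sq m₁ σ₁
  rw [d₀] at e₀
  rw [d₁] at e₁
  have hk0 := (r t).maxCorr_nonneg
  have hks := (r t).maxCorr_le_stdDev
  set m := (r t).mean
  set s := (r t).stdDev
  set k := (r t).maxCorr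
  -- By k ≤ s, the squared distance u²D² to the second Gaussian is at least (m₁ - m)² + (σ₁ - s)².
  have he : |m₁ - m| ≤ u * D := by
    refine abs_le_of_sq_le_sq ?_ (by positivity)
    nlinarith [mul_le_mul_of_nonneg_left hks hσ₁, sq_nonneg ((σ₁ : ℝ) - s)]
  have hprod : (m₀ - m₁) * (m₁ - m) ≤ |m₀ - m₁| * (u * D) :=
    (le_abs_self _).trans (by rw [abs_mul]; gcongr)
  have hbk : 0 ≤ ((σ₀ : ℝ) - σ₁) * k := mul_nonneg (by linarith) hk0
  -- Subtracting `e₁` from `e₀` cancels s² and gives (1 + 2u)D² = K + 2(m₀ - m₁)(m₁ - m) - 2(σ₀ -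
  -- σ₁)k, where the last term is at most 0.
  nlinarith [sq_pos_of_pos hDpos]

theorem corollary2 (m₀ m₁ : ℝ) (σ₀ σ₁ : ℝ≥0) :
    (∃! c : unitInterval → P2, IsGeodesicBetween (gaussianP2 m₀ σ₀) (gaussianP2 m₁ σ₁) c) ∧
      ∀ c : unitInterval → P2, IsGeodesicBetween (gaussianP2 m₀ σ₀) (gaussianP2 m₁ σ₁) c →
        (IsRay c ↔ σ₀ ≤ σ₁) := by
  refine ⟨⟨_, isGeodesicBetween_gaussianInterp m₀ m₁ σ₀ σ₁,
    fun c hc => funext hc.eq_gaussianInterp⟩, fun c hc => ⟨?_, fun hσ => ?_⟩⟩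
  · rintro ⟨r, hr, hrc⟩
    exact hr.le_of_gaussian ((hrc 0).trans hc.source) ((hrc 1).trans hc.target)
  · refine ⟨fun t => gaussianInterp m₀ m₁ σ₀ σ₁ t, fun s t => ?_,
      fun t => (hc.eq_gaussianInterp t).symm⟩
    have hnn : ∀ u : ℝ≥0, 0 ≤ (1 - (u : ℝ)) * (σ₀ : ℝ) + u * σ₁ := fun u => by
      have : (σ₀ : ℝ) ≤ σ₁ := by exact_mod_cast hσ
      nlinarith [mul_nonneg u.2 (sub_nonneg.2 this), σ₀.coe_nonneg]
    rw [W2_gaussianInterp (hnn s) (hnn t)]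
    simp [gaussianInterp_zero, gaussianInterp_one]
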